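/- Let $\mathbb{F}_q$ be a finite field of characteristic $p$, let $\mathbb{Z}_q=W(\mathbb{F}_q)$ be its ring of Witt vectors and $\mathbb{Q}_q$ the fraction field of $\mathbb{Z}_q$. Let $Q\in\mathbb{F}_q[x,y]$ be irreducible, monic in $y$ of degree $d_x$, and separable as a polynomial in $y$ over $\mathbb{F}_q(x)$. Let $\mathcal{Q}\in\mathbb{Z}_q[x,y]$ be a lift of $Q$ which is monic in $y$ and has the same monomials in its support as $Q$. Let $\Delta\in\mathbb{Z}_q[x]$ be the discriminant of $\mathcal{Q}$ with respect to $y$, and let $r=\Delta/\gcd(\Delta,\frac{d\Delta}{dx})$. Assume that the zero locus of $\mathcal{Q}$ in the affine plane $\mathbf{A}^2_{\mathbb{Q}_q}$ is smooth over $\mathbb{Q}_q$. Let $\mathbb{X}$ be the smooth projective curve over $\mathbb{Q}_q$ with function field $\mathbb{Q}_q(x,y)=\operatorname{Frac}\bigl(\mathbb{Q}_q[x,y]/(\mathcal{Q})\bigr)$, and let $\mathbb{U}=\operatorname{Spec}\mathbb{Q}_q[x,1/r,y]/(\mathcal{Q})$, which is an open subset of $\mathbb{X}$. For a closed point $P\in\mathbb{X}\setminus\mathbb{U}$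 let $z_P$ be any local coordinate at $P$, and for a rational $1$-form $\omega$ on $\mathbb{X}$ let $\operatorname{res}_P(\omega)\in\mathcal{O}_{\mathbb{X},P}/(z_P)$ be the coefficient $a_{-1}$ in the Laurent series expansion $\omega=\bigl(\sum_{i\ge -k}a_iz_P^i\bigr)\,dz_P$ at $P$, where the $a_i$ lie in the residue field at $P$. Let $u_0,\dots,u_{d_x-1}\in\mathbb{Q}_q[x]$ and $$\omega=\Bigl(\sum_{i=0}^{d_x-1}u_i(x)\,y^i\Bigr)\frac{dx}{r}.$$ Then $$\operatorname{res}_P(\omega)=0\ \text{ for all } P\in\mathbb{X}\setminus\mathbb{U}\text{ with }x(P)\neq\infty \quad\Longleftrightarrow\quad \frac{\partial\mathcal{Q}}{\partial y}\sum_{i=0}^{d_x-1}u_iy^i=0\ \text{ in }\ \mathcal{O}\bigl(\mathbb{X}-x^{-1}(\infty)\bigr)/(r).$$ -/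

import Mathlib

open Polynomial

namespace CurveResidue

noncomputable section

/-! ### The smooth projective curve with a given function field -/

/-- A closed point of the smooth projective curve with function field `L` over `K`: a valuation
ring `𝒪_P` of `L` which contains `K` and is not all of `L`. When `L` is a function field in one
variable over `K`, these are the local rings of the curve at its closed points, and they are
discrete valuation rings. -/
structure Place (K L : Type*) [Field K] [Field L] [Algebra K L] where
  /-- The local ring `𝒪_P`. -/
  ring : ValuationSubring L
  algebraMap_mem : ∀ c : K, algebraMap K L c ∈ ring
  ne_top : ring ≠ ⊤

section Points

variable {K L : Type*} [Field K] [Field L] [Algebra K L]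

/-- The residue field `𝒪_P / (z_P)` at `P`. -/
abbrev Place.ResidueField (P : Place K L) : Type _ := IsLocalRing.ResidueField P.ring

/-- `z` is a local coordinate at `P`: it generates the maximal ideal of `𝒪_P`. -/
def IsLocalCoordinate (P : Place K L) (z : L) : Prop :=
  ∃ hz : z ∈ P.ring, IsLocalRing.maximalIdeal P.ring = Ideal.span {(⟨z, hz⟩ : P.ring)}

/-- `φ` is the Laurent series expansion at `P` in the local coordinate `z`: the embedding over `K`
of `L` into the field of Laurent series over the residue field at `P` which sends `z` to the
variable, and sends a function regular at `P` to a power series whose constant coefficient is the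
value of the function at `P`. (In characteristic zero there is exactly one such `φ`.) -/
structure IsLaurentExpansion (P : Place K L) (z : L)
    (φ : L →+* LaurentSeries P.ResidueField) : Prop where
  map_const : ∀ c : K, φ (algebraMap K L c) =
    HahnSeries.C (IsLocalRing.residue P.ring ⟨algebraMap K L c, P.algebraMap_mem c⟩)
  map_coordinate : φ z = HahnSeries.single (1 : ℤ) 1
  map_regular : ∀ f : P.ring, ∃ s : PowerSeries P.ResidueField,
    φ f = HahnSeries.ofPowerSeries ℤ P.ResidueField s ∧
      PowerSeries.constantCoeff s = IsLocalRing.residue P.ring f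

/-- `HasResidue P z ω a` says that `res_P(ω) = a`: the rational `1`-form `ω` is `f dz`, and in the
Laurent series expansion of `f` at `P` in the local coordinate `z` the coefficient of `z⁻¹`
is `a`. -/
def HasResidue (P : Place K L) (z : L) (ω : Ω[L⁄K]) (a : P.ResidueField) : Prop :=
  ∃ (φ : L →+* LaurentSeries P.ResidueField) (f : L),
    IsLaurentExpansion P z φ ∧ ω = f • KaehlerDifferential.D K L z ∧ (φ f).coeff (-1) = a

variable (K) in
/-- The ring of functions regular at all points of the curve at which `x` does not have a pole,
that is `𝒪(𝕏 - x⁻¹(∞))`, as a subring of the function field. -/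
def regularAwayFromInfinity (x : L) : Subalgebra K L where
  carrier := {f | ∀ P : Place K L, x ∈ P.ring → f ∈ P.ring}
  mul_mem' hf hg P hP := mul_mem (hf P hP) (hg P hP)
  add_mem' hf hg P hP := add_mem (hf P hP) (hg P hP)
  algebraMap_mem' c P _ := P.algebraMap_mem c

end Points

/-! ### Plane curves `F(x, y) = 0`

A polynomial in `x` and `y` is an element of `K[X][X]`: the inner variable is `x`, the outer
variable is `y`. -/

section PlaneCurve

variable {K : Type*} [Field K] (F : K[X][X])
variable (L : Type*) [Field L] [Algebra (AdjoinRoot F) L]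

/-- The image in `L` of a polynomial in `x`. -/
def ofX (c : K[X]) : L := algebraMap (AdjoinRoot F) L (AdjoinRoot.of F c)

/-- The function `x`. -/
def xFun : L := ofX F L X

/-- The function `y`. -/
def yFun : L := algebraMap (AdjoinRoot F) L (AdjoinRoot.root F)

variable [Algebra K L] [IsScalarTower K (AdjoinRoot F) L]

theorem ofX_mem (P : Place K L) (hP : xFun F L ∈ P.ring) (c : K[X]) : ofX F L c ∈ P.ring := by
  induction c using Polynomial.induction_on' with
  | add f g hf hg =>
    have : ofX F L (f + g) = ofX F L f + ofX F L g := by simp [ofX]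
    rw [this]; exact add_mem hf hg
  | monomial n a =>
    have h : ofX F L (monomial n a) = algebraMap K L a * xFun F L ^ n := by
      rw [IsScalarTower.algebraMap_apply K (AdjoinRoot F) L,
        IsScalarTower.algebraMap_apply K K[X] (AdjoinRoot F), xFun, ofX, ofX, ← map_pow,
        ← map_pow, AdjoinRoot.algebraMap_eq, ← map_mul, ← map_mul, ← C_mul_X_pow_eq_monomial]
      rfl
    rw [h]; exact mul_mem (P.algebraMap_mem a) (pow_mem hP n)

variable {F} in
theorem yFun_mem (hF : F.Monic) (P : Place K L) (hP : xFun F L ∈ P.ring) :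
    yFun F L ∈ P.ring := by
  let ψ : K[X] →+* P.ring :=
    ((algebraMap (AdjoinRoot F) L).comp (AdjoinRoot.of F)).codRestrict P.ring.toSubring
      (ofX_mem F L P hP)
  have h : IsIntegral P.ring (yFun F L) := by
    refine ⟨F.map ψ, hF.map ψ, ?_⟩
    rw [eval₂_map]
    have := congrArg (algebraMap (AdjoinRoot F) L) (AdjoinRoot.eval₂_root F)
    rwa [hom_eval₂, map_zero] at this
  obtain ⟨w, hw⟩ := IsIntegrallyClosed.isIntegral_iff.mp h
  rw [← hw]; exact w.2

variable {F} in
theorem algebraMap_mem_regular (hF : F.Monic) (a : AdjoinRoot F) :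
    algebraMap (AdjoinRoot F) L a ∈ regularAwayFromInfinity K (xFun F L) := by
  intro P hP
  induction a using AdjoinRoot.induction_on with
  | ih g =>
    induction g using Polynomial.induction_on' with
    | add f g hf hg => rw [map_add, map_add]; exact add_mem hf hg
    | monomial n c =>
      have h : algebraMap (AdjoinRoot F) L (AdjoinRoot.mk F (monomial n c)) =
          ofX F L c * yFun F L ^ n := by
        rw [← C_mul_X_pow_eq_monomial, map_mul, map_mul, map_pow, map_pow, AdjoinRoot.mk_X,
          AdjoinRoot.mk_C]
        rfl
      rw [h]; exact mul_mem (ofX_mem F L P hP c) (pow_mem (yFun_mem L hF P hP) n)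

variable {F} in
/-- A polynomial in `x` and `y`, as a regular function on `𝕏 - x⁻¹(∞)`. -/
def toRegular (hF : F.Monic) : AdjoinRoot F →+* regularAwayFromInfinity K (xFun F L) :=
  (algebraMap (AdjoinRoot F) L).codRestrict (regularAwayFromInfinity K (xFun F L))
    (algebraMap_mem_regular L hF)

/-- `P` lies on the open subset `𝕌 = Spec K[x, 1/r, y]/(F)` of the curve: the coordinate ring of
`𝕌` is contained in the local ring at `P`. -/
def LiesOnU (r : K[X]) (P : Place K L) : Prop :=
  ∀ f ∈ Algebra.adjoin K {xFun F L, (ofX F L r)⁻¹, yFun F L}, f ∈ P.ring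

end PlaneCurve

/-! ### Lifts -/

/-- `r = Δ / gcd(Δ, dΔ/dx)`, for some choice of the greatest common divisor (which is unique up to
a unit). -/
def IsSquarefreePart {R : Type*} [CommRing R] (Δ r : R[X]) : Prop :=
  ∃ g : R[X], (∀ d : R[X], d ∣ g ↔ d ∣ Δ ∧ d ∣ derivative Δ) ∧ Δ = r * g

/-- `𝒬` is a lift of `Q` to the Witt vectors of `k` with the same monomials in its support as `Q`,
and monic in `y`. -/
structure IsGoodLift {p : ℕ} [Fact p.Prime] {k : Type*} [Field k] [CharP k p]
    (Q : k[X][X]) (𝒬 : (WittVector p k)[X][X]) : Prop where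
  map_eq : 𝒬.map (mapRingHom WittVector.constantCoeff) = Q
  support : ∀ i j : ℕ, (𝒬.coeff j).coeff i ≠ 0 ↔ (Q.coeff j).coeff i ≠ 0
  monic : 𝒬.Monic

/-- The polynomial `𝒬` over the fraction field. -/
abbrev genericFibre {R : Type*} [CommRing R] (K : Type*) [Field K] [Algebra R K] (𝒬 : R[X][X]) :
    K[X][X] :=
  𝒬.map (mapRingHom (algebraMap R K))

end

end CurveResidue

/-!
Write `F` for the equation of the curve over the field `K` of characteristic zero, `F_x` and `F_y`
for its partial derivatives, `S = ∑ uᵢ yⁱ`, and `v` for the valuation at a point `P` with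
`x(P) ≠ ∞`. Both conditions turn out to be the same condition at each such `P` with `r(P) = 0`,
namely that `S` vanishes at `P`. At the points with `r(P) ≠ 0` there is nothing to show.

The reason is that `dx` and `F_y` have the same order at `P`. The derivation `δ` of the function
field with `δ x = F_y` and `δ y = -F_x` maps the coordinate ring `A = K[x, y]/(F)` to itself. Since
the curve is smooth, `F_x` and `F_y` generate the unit ideal of `A`
(`exists_jacobian_eq_one_of_smooth`), and the localization of `A` at the center of `P` is a
valuation ring (`isPrincipal_maximalIdeal_atPrime`), hence equal to the local ring at `P`
(`Place.exists_eq_div`). So `δ` preserves that local ring. If `δ` mapped a local coordinate `z` into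
the maximal ideal, it would preserve the maximal ideal and induce a derivation of the residue field
over `K`, which is zero because the residue field is algebraic over `K`; then `F_x` and `F_y` would
both vanish at `P`. Hence `δ z` is a unit, `D = δ / δ z` is `d/dz`, and `dx/dz = F_y / δ z`.

On the other hand `r` is separable (`IsSquarefreePart.separable_map`), so tame ramification gives
`v(r) = v(dx/dz) + 1` (`IsLocalCoordinate.valuation_mul_deriv_div`). Therefore `S dx / r` has at most
a simple pole at `P`, with residue zero exactly when `v(S) > 0`, and `v(F_y S) ≥ v(r)` also means
`v(S) > 0`. The Laurent expansion at `P` needed to speak of the residue is the Taylor expansion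
`f ↦ ∑ (Dⁿ f)(P) / n! zⁿ` (`exists_isLaurentExpansion`).
-/

namespace CurveResidue

noncomputable section

/-! ### Taylor expansion along a derivation -/

section Taylor

variable {R κ : Type*} [CommRing R] [Field κ]

/-- The formal Taylor expansion `f ↦ ∑ π(Dⁿ f) / n! Tⁿ` along a derivation `D`, with values in
a field `κ` through a ring homomorphism `π`. It is multiplicative when `κ` has characteristic zero;
otherwise some of the inverses `1 / n!` are zero by convention. -/
def taylorSeries (D : Derivation ℤ R R) (π : R →+* κ) (f : R) : PowerSeries κ :=
  PowerSeries.mk fun n => (n.factorial : κ)⁻¹ * π (D^[n] f)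

variable (D : Derivation ℤ R R) (π : R →+* κ)

theorem constantCoeff_taylorSeries (f : R) :
    PowerSeries.constantCoeff (taylorSeries D π f) = π f := by
  rw [← PowerSeries.coeff_zero_eq_constantCoeff_apply]
  simp [taylorSeries]

theorem derivative_taylorSeries [CharZero κ] (f : R) :
    PowerSeries.derivative κ (taylorSeries D π f) = taylorSeries D π (D f) := by
  ext n
  rw [PowerSeries.coeff_derivative]
  simp only [taylorSeries, PowerSeries.coeff_mk, Function.iterate_succ_apply, Nat.factorial_succ]
  have h1 : ((n : κ) + 1) ≠ 0 := by exact_mod_cast n.succ_ne_zero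
  have h2 : (n.factorial : κ) ≠ 0 := by exact_mod_cast n.factorial_ne_zero
  push_cast
  field_simp

theorem taylorSeries_add (f g : R) :
    taylorSeries D π (f + g) = taylorSeries D π f + taylorSeries D π g := by
  ext n
  simp only [taylorSeries, PowerSeries.coeff_mk, map_add]
  have : D^[n] (f + g) = D^[n] f + D^[n] g := by
    rw [iterate_map_add]
  rw [this, map_add, mul_add]

/-- Both sides have the same constant coefficient, and by induction the same derivative. -/
theorem taylorSeries_mul [CharZero κ] (f g : R) :
    taylorSeries D π (f * g) = taylorSeries D π f * taylorSeries D π g := by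
  suffices h : ∀ (n : ℕ) (f g : R), PowerSeries.coeff n (taylorSeries D π (f * g)) =
      PowerSeries.coeff n (taylorSeries D π f * taylorSeries D π g) by
    ext n; exact h n f g
  intro n
  induction n with
  | zero =>
    intro f g
    simp only [PowerSeries.coeff_zero_eq_constantCoeff_apply, map_mul,
      constantCoeff_taylorSeries]
  | succ n ih =>
    intro f g
    have h1 : ((n : κ) + 1) ≠ 0 := by exact_mod_cast n.succ_ne_zero
    apply mul_right_cancel₀ h1
    rw [← PowerSeries.coeff_derivative, ← PowerSeries.coeff_derivative, derivative_taylorSeries,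
      Derivation.leibniz, Derivation.leibniz, taylorSeries_add, derivative_taylorSeries,
      derivative_taylorSeries, map_add, map_add, smul_eq_mul, smul_eq_mul, ih, ih, smul_eq_mul,
      smul_eq_mul]

theorem taylorSeries_of_map_eq_zero {f : R} (hf : D f = 0) :
    taylorSeries D π f = PowerSeries.C (π f) := by
  ext n
  cases n with
  | zero => simp [taylorSeries]
  | succ n =>
    simp [taylorSeries, Function.iterate_succ_apply, hf,
      iterate_map_zero]

theorem taylorSeries_of_map_eq_one {f : R} (hf : D f = 1) (h0 : π f = 0) :
    taylorSeries D π f = PowerSeries.X := by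
  ext n
  match n with
  | 0 => simp [taylorSeries, h0]
  | 1 => simp [taylorSeries, hf]
  | n + 2 =>
    simp [taylorSeries, PowerSeries.coeff_X, Function.iterate_succ_apply, hf, iterate_map_zero]

/-- The Taylor expansion as a ring homomorphism. -/
def taylorHom [CharZero κ] : R →+* PowerSeries κ where
  toFun := taylorSeries D π
  map_one' := by
    rw [taylorSeries_of_map_eq_zero D π (Derivation.map_one_eq_zero D), map_one, map_one]
  map_mul' := taylorSeries_mul D π
  map_zero' := by
    rw [taylorSeries_of_map_eq_zero D π (map_zero D), map_zero, map_zero]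
  map_add' := taylorSeries_add D π

end Taylor

/-! ### Laurent expansions and residues at a place -/

section Place

variable {K L : Type*} [Field K] [Field L] [Algebra K L]

/-- The local ring at `P` as an algebra over the constants. -/
abbrev Place.algebra (P : Place K L) : Algebra K P.ring :=
  ((algebraMap K L).codRestrict P.ring.toSubring P.algebraMap_mem).toAlgebra

theorem Place.valuation_algebraMap (P : Place K L) {c : K} (hc : c ≠ 0) :
    P.ring.valuation (algebraMap K L c) = 1 := by
  have h1 := (P.ring.valuation_le_one_iff _).2 (P.algebraMap_mem c)
  have h2 := (P.ring.valuation_le_one_iff _).2 (P.algebraMap_mem c⁻¹)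
  apply le_antisymm h1
  have h3 : P.ring.valuation (algebraMap K L c) * P.ring.valuation (algebraMap K L c⁻¹) = 1 := by
    rw [← map_mul, ← map_mul, mul_inv_cancel₀ hc, map_one, map_one]
  calc (1 : P.ring.ValueGroup) = _ := h3.symm
    _ ≤ P.ring.valuation (algebraMap K L c) * 1 := by gcongr
    _ = _ := mul_one _

theorem Place.charZero_residueField [CharZero K] (P : Place K L) : CharZero P.ResidueField := by
  let := P.algebra
  exact charZero_of_injective_algebraMap (algebraMap K P.ResidueField).injective

theorem Place.residue_eq_zero_iff (P : Place K L) (f : P.ring) :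
    IsLocalRing.residue P.ring f = 0 ↔ P.ring.valuation f < 1 := by
  rw [IsLocalRing.residue_eq_zero_iff, ValuationSubring.valuation_lt_one_iff]

variable {P : Place K L} {z : L}

theorem IsLocalCoordinate.valuation_lt_one (hz : IsLocalCoordinate P z) :
    P.ring.valuation z < 1 := by
  obtain ⟨hz', h⟩ := hz
  refine (P.ring.valuation_lt_one_iff ⟨z, hz'⟩).1 ?_
  rw [h]
  exact Ideal.mem_span_singleton_self _

theorem IsLocalCoordinate.exists_eq_mul (hz : IsLocalCoordinate P z) {a : L}
    (ha : P.ring.valuation a < 1) : ∃ b ∈ P.ring, a = z * b := by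
  obtain ⟨hz', h⟩ := hz
  have ha' : a ∈ P.ring := (P.ring.valuation_le_one_iff a).1 ha.le
  have := (P.ring.valuation_lt_one_iff ⟨a, ha'⟩).2 ha
  rw [h, Ideal.mem_span_singleton] at this
  obtain ⟨b, hb⟩ := this
  exact ⟨b, b.2, congrArg Subtype.val hb⟩

theorem IsLocalCoordinate.valuation_lt_one_iff (hz : IsLocalCoordinate P z) (a : L) :
    P.ring.valuation a < 1 ↔ P.ring.valuation a ≤ P.ring.valuation z := by
  refine ⟨fun ha => ?_, fun ha => ha.trans_lt hz.valuation_lt_one⟩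
  obtain ⟨b, hb, rfl⟩ := hz.exists_eq_mul ha
  rw [map_mul]
  exact mul_le_of_le_one_right' ((P.ring.valuation_le_one_iff b).2 hb)

theorem IsLocalCoordinate.exists_eq_pow_mul [IsNoetherianRing P.ring]
    (hz : IsLocalCoordinate P z) {f : L} (hf : f ∈ P.ring) (hf0 : f ≠ 0) :
    ∃ (n : ℕ) (w : L), f = z ^ n * w ∧ P.ring.valuation w = 1 := by
  have hz' := hz
  obtain ⟨hzm, h⟩ := hz'
  have hu : ¬ IsUnit (⟨z, hzm⟩ : P.ring) := fun hu =>
    hz.valuation_lt_one.ne ((P.ring.valuation_eq_one_iff _).1 hu)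
  have hfin : FiniteMultiplicity (⟨z, hzm⟩ : P.ring) ⟨f, hf⟩ :=
    FiniteMultiplicity.of_not_isUnit hu fun h0 => hf0 (congrArg Subtype.val h0)
  obtain ⟨c, hc, hzc⟩ := hfin.exists_eq_pow_mul_and_not_dvd
  refine ⟨_, c, congrArg Subtype.val hc, ?_⟩
  rcases P.ring.valuation_lt_one_or_eq_one c with h1 | h1
  · rw [← ValuationSubring.valuation_lt_one_iff, h, Ideal.mem_span_singleton] at h1
    exact absurd h1 hzc
  · exact h1

/-- A derivation of `L` under which the local ring at `P` is stable, restricted to it. -/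
def restrictDerivation (P : Place K L) (D : Derivation K L L)
    (hD : ∀ f ∈ P.ring, D f ∈ P.ring) : Derivation ℤ P.ring P.ring :=
  Derivation.mk' (AddMonoidHom.toIntLinearMap
    { toFun := fun f => ⟨D f, hD f f.2⟩
      map_zero' := Subtype.ext (map_zero D)
      map_add' := fun a b => Subtype.ext (map_add D (a : L) b) })
    fun a b => Subtype.ext (D.leibniz (a : L) b)

/-- In characteristic zero, the Taylor expansion along `D = d/dz` extends to the Laurent
expansion at `P` in the coordinate `z`. -/
theorem exists_isLaurentExpansion [CharZero K] [IsNoetherianRing P.ring]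
    (hz : IsLocalCoordinate P z) (D : Derivation K L L) (hD : ∀ f ∈ P.ring, D f ∈ P.ring)
    (hDz : D z = 1) : ∃ φ : L →+* LaurentSeries P.ResidueField, IsLaurentExpansion P z φ := by
  have := P.charZero_residueField
  let E := restrictDerivation P D hD
  let T := taylorHom E (IsLocalRing.residue P.ring)
  let ψ : P.ring →+* LaurentSeries P.ResidueField :=
    (HahnSeries.ofPowerSeries ℤ P.ResidueField).comp T
  have hzm : z ∈ P.ring := hz.choose
  have hTz : T ⟨z, hzm⟩ = PowerSeries.X :=
    taylorSeries_of_map_eq_one E _ (Subtype.ext hDz)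
      ((P.residue_eq_zero_iff _).2 hz.valuation_lt_one)
  have hψ : Function.Injective ψ := by
    rw [injective_iff_map_eq_zero]
    intro f hf
    by_contra hf0
    obtain ⟨n, w, hfw, hw⟩ := hz.exists_eq_pow_mul f.2 fun h0 => hf0 (Subtype.ext h0)
    have hwm : w ∈ P.ring := (P.ring.valuation_le_one_iff w).1 hw.le
    have hTf : T f = 0 := HahnSeries.ofPowerSeries_injective (hf.trans (map_zero _).symm)
    have hf' : f = (⟨z, hzm⟩ : P.ring) ^ n * ⟨w, hwm⟩ := Subtype.ext hfw
    rw [hf', map_mul, map_pow, hTz] at hTf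
    have hTw : T ⟨w, hwm⟩ = 0 :=
      (mul_eq_zero.1 hTf).resolve_left (pow_ne_zero _ PowerSeries.X_ne_zero)
    have h0 := constantCoeff_taylorSeries E (IsLocalRing.residue P.ring) ⟨w, hwm⟩
    rw [show taylorSeries E (IsLocalRing.residue P.ring) ⟨w, hwm⟩ = 0 from hTw, map_zero, eq_comm,
      P.residue_eq_zero_iff] at h0
    exact h0.ne hw
  have hφ : ∀ f : P.ring, IsFractionRing.lift hψ (f : L) =
      HahnSeries.ofPowerSeries ℤ P.ResidueField (T f) := fun f =>
    IsFractionRing.lift_algebraMap hψ f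
  refine ⟨IsFractionRing.lift hψ, ?_, ?_, ?_⟩
  · intro c
    have h := hφ ⟨algebraMap K L c, P.algebraMap_mem c⟩
    refine h.trans ?_
    have hT : T ⟨algebraMap K L c, P.algebraMap_mem c⟩ = PowerSeries.C _ :=
      taylorSeries_of_map_eq_zero E _ (Subtype.ext (D.map_algebraMap c))
    rw [hT, HahnSeries.ofPowerSeries_C]
  · refine (hφ ⟨z, hzm⟩).trans ?_
    rw [hTz, HahnSeries.ofPowerSeries_X]
  · exact fun f => ⟨T f, hφ f, constantCoeff_taylorSeries _ _ f⟩

/-- A form with at most a simple pole has residue zero exactly when it has no pole: its residue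
is the value of `z f` at `P`, where `ω = f dz`. -/
theorem hasResidue_zero_iff [CharZero K] [IsNoetherianRing P.ring]
    (hz : IsLocalCoordinate P z) (D : Derivation K L L) (hD : ∀ f ∈ P.ring, D f ∈ P.ring)
    (hDz : D z = 1) {f : L} (hf : z * f ∈ P.ring) :
    HasResidue P z (f • KaehlerDifferential.D K L z) 0 ↔ P.ring.valuation (z * f) < 1 := by
  have key : ∀ φ : L →+* LaurentSeries P.ResidueField, IsLaurentExpansion P z φ →
      ((φ f).coeff (-1) = 0 ↔ P.ring.valuation (z * f) < 1) := by
    intro φ hφ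
    obtain ⟨s, hs, hs0⟩ := hφ.map_regular ⟨z * f, hf⟩
    have h1 : (φ (z * f)).coeff 0 = (φ f).coeff (-1) := by
      rw [map_mul, hφ.map_coordinate]
      have := HahnSeries.coeff_single_mul_add (r := (1 : P.ResidueField)) (x := φ f) (a := -1)
        (b := (1 : ℤ))
      rw [one_mul] at this
      rw [← this]
      norm_num
    have h2 : (φ (z * f)).coeff 0 = PowerSeries.constantCoeff s := by
      rw [show φ (z * f) = _ from hs, ← PowerSeries.coeff_zero_eq_constantCoeff_apply]
      exact HahnSeries.ofPowerSeries_apply_coeff s 0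
    rw [← h1, h2, hs0, P.residue_eq_zero_iff]
  constructor
  · rintro ⟨φ, g, hφ, hg, h0⟩
    -- contracting with `D` recovers the coefficient of `dz`
    have hfg : f = g := by
      have := congrArg D.liftKaehlerDifferential hg
      simpa [hDz] using this
    rw [← hfg] at h0
    exact (key φ hφ).1 h0
  · intro h
    obtain ⟨φ, hφ⟩ := exists_isLaurentExpansion hz D hD hDz
    exact ⟨φ, f, hφ, rfl, (key φ hφ).2 h⟩

end Place

/-! ### Partial derivatives of bivariate polynomials and the Jacobian criterion -/

section Bivariate

variable {K : Type*} [Field K]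

variable (K) in
/-- The partial derivative `∂/∂x` on `K[x][y]`. The partial derivative `∂/∂y` is
`Polynomial.derivative`. -/
def derivX : Derivation K K[X][X] K[X][X] :=
  PolynomialModule.equivPolynomialSelf.compDer derivative'.mapCoeffs

theorem derivX_C (c : K[X]) : derivX K (C c) = C (derivative c) := by
  simp [derivX]

theorem derivX_X : derivX K (X : K[X][X]) = 0 := by
  simp [derivX]

variable {B M : Type*} [CommRing B] [Algebra K B] [AddCommGroup M] [Module B M] [Module K M]

/-- The chain rule `d (G(x, y)) = G_x(x, y) dx + G_y(x, y) dy`. -/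
theorem derivation_aevalAeval (d : Derivation K B M) (x y : B) (G : K[X][X]) :
    d (aevalAeval x y G) = aevalAeval x y (derivX K G) • d x +
      aevalAeval x y (derivative G) • d y := by
  induction G using Polynomial.induction_on' with
  | add f g hf hg =>
    simp only [map_add, hf, hg, add_smul]
    abel
  | monomial n c =>
    have hc : d (aeval x c) = aeval x (derivative c) • d x := d.map_aeval c x
    have h1 : derivX K (C c * X ^ n) = C (derivative c) * X ^ n := by
      rw [Derivation.leibniz, Derivation.leibniz_pow, derivX_X, derivX_C, smul_zero, smul_zero,
        smul_zero, zero_add, smul_eq_mul, mul_comm]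
    have h2 : derivative (C c * X ^ n) = C c * ((n : K[X][X]) * X ^ (n - 1)) := by
      rw [derivative_C_mul, derivative_X_pow, C_eq_natCast]
    rw [← C_mul_X_pow_eq_monomial, h1, h2]
    simp only [map_mul, map_pow, map_natCast, aevalAeval_C, aevalAeval_Y]
    rw [Derivation.leibniz, hc, Derivation.leibniz_pow, ← Nat.cast_smul_eq_nsmul B]
    simp only [smul_smul]
    rw [add_comm, mul_comm (y ^ n)]

/-- The first order Taylor formula: two evaluations of a polynomial at points which agree modulo
an ideal of square zero. -/
theorem eq_add_of_sq_eq_bot [Algebra K[X][X] B] [IsScalarTower K K[X][X] B] (I : Ideal B)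
    (hI : I ^ 2 = ⊥) (f : K[X][X] →ₐ[K] B)
    (hf : ∀ G, f G - algebraMap K[X][X] B G ∈ I) (G : K[X][X]) :
    f G = algebraMap K[X][X] B G +
      (algebraMap K[X][X] B (derivX K G) * (f (C X) - algebraMap K[X][X] B (C X)) +
      algebraMap K[X][X] B (derivative G) * (f X - algebraMap K[X][X] B X)) := by
  have e : (Ideal.Quotient.mkₐ K I).comp f = IsScalarTower.toAlgHom K K[X][X] (B ⧸ I) := by
    refine AlgHom.ext fun u => ?_
    change Ideal.Quotient.mk I (f u) = Ideal.Quotient.mk I (algebraMap K[X][X] B u)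
    rw [Ideal.Quotient.eq]
    exact hf u
  let d := derivationToSquareZeroOfLift I hI f e
  have hd : ∀ G : K[X][X], (d G : B) = f G - algebraMap K[X][X] B G := fun G => rfl
  have hchain := derivation_aevalAeval d (C X) X G
  have hid : ∀ G : K[X][X], aevalAeval (C X : K[X][X]) X G = G := by
    intro G
    have : aevalAeval (C X : K[X][X]) X = AlgHom.id K K[X][X] :=
      algHom_ext' (by ext; simp) (by simp)
    rw [this, AlgHom.id_apply]
  simp only [hid] at hchain
  have h1 := congrArg (Subtype.val : I → B) hchain
  rw [← hd, ← hd, ← sub_eq_iff_eq_add', ← hd, h1, ← Algebra.smul_def, ← Algebra.smul_def]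
  rfl

/-- If `K[x, y]/(F)` is formally smooth, its identity map lifts to `B = K[x, y]/(F²)`, and such a
lift `x ↦ x + aF`, `y ↦ y + bF` satisfies `F + (a F_x + b F_y) F = 0`. -/
theorem exists_jacobian_eq_one_of_formallySmooth [Algebra K[X][X] B] [IsScalarTower K K[X][X] B]
    {A : Type*} [CommRing A] [Algebra K A] [Algebra.FormallySmooth K A] {F : K[X][X]} (hF0 : F ≠ 0)
    (hB : Function.Surjective (algebraMap K[X][X] B))
    (hB0 : ∀ G, algebraMap K[X][X] B G = 0 ↔ F ^ 2 ∣ G)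
    (π : K[X][X] →ₐ[K] A) (hπ0 : ∀ G, π G = 0 ↔ F ∣ G) (g : B →ₐ[K] A)
    (hgπ : ∀ G, g (algebraMap K[X][X] B G) = π G) (hg : Function.Surjective g) :
    ∃ a b c : K[X][X], a * derivX K F + b * derivative F + c * F = 1 := by
  have hker : ∀ u, u ∈ RingHom.ker g → ∃ a : K[X][X], u = algebraMap K[X][X] B (a * F) := by
    intro u hu
    obtain ⟨w, rfl⟩ := hB u
    rw [RingHom.mem_ker, hgπ, hπ0] at hu
    obtain ⟨a, rfl⟩ := hu
    exact ⟨a, by rw [mul_comm]⟩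
  have hI : RingHom.ker g ^ 2 = ⊥ := by
    rw [eq_bot_iff, pow_two, Ideal.mul_le]
    intro u hu v hv
    obtain ⟨a, rfl⟩ := hker u hu
    obtain ⟨b, rfl⟩ := hker v hv
    rw [← map_mul, Submodule.mem_bot, hB0]
    exact ⟨a * b, by ring⟩
  obtain ⟨σ, hσ⟩ : ∃ σ : A →ₐ[K] B, ∀ u, g (σ u) = u :=
    ⟨_, Algebra.FormallySmooth.liftOfSurjective_apply (AlgHom.id K _) g hg ⟨2, hI⟩⟩
  have hf : ∀ G, (σ.comp π) G - algebraMap K[X][X] B G ∈ RingHom.ker g := by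
    intro G
    rw [RingHom.mem_ker, map_sub, sub_eq_zero]
    exact (hσ _).trans (hgπ G).symm
  obtain ⟨a, ha⟩ := hker _ (hf (C X))
  obtain ⟨b, hb⟩ := hker _ (hf X)
  have h1 := eq_add_of_sq_eq_bot _ hI (σ.comp π) hf F
  rw [ha, hb, AlgHom.comp_apply, (hπ0 F).2 dvd_rfl, map_zero, ← map_mul, ← map_mul, ← map_add,
    ← map_add, eq_comm, hB0] at h1
  obtain ⟨c, hc⟩ := h1
  refine ⟨-a, -b, c, ?_⟩
  apply mul_left_cancel₀ hF0
  linear_combination -hc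

/-- The Jacobian criterion for a smooth plane curve `F = 0`: the partial derivatives of `F` have
no common zero on it. -/
theorem exists_jacobian_eq_one_of_smooth (F : K[X][X]) (hF0 : F ≠ 0)
    (h : Algebra.Smooth K (AdjoinRoot F)) :
    ∃ a b c : K[X][X], a * derivX K F + b * derivative F + c * F = 1 := by
  have := h.formallySmooth
  let π : K[X][X] →ₐ[K] AdjoinRoot F := (AdjoinRoot.mkₐ F).restrictScalars K
  have hπ : ∀ G, π G = AdjoinRoot.mk F G := fun G => rfl
  let g : (K[X][X] ⧸ Ideal.span {F ^ 2}) →ₐ[K] AdjoinRoot F :=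
    Ideal.Quotient.liftₐ _ π fun a ha => by
      rw [Ideal.mem_span_singleton] at ha
      rw [hπ, AdjoinRoot.mk_eq_zero]
      exact (dvd_pow_self F two_ne_zero).trans ha
  refine exists_jacobian_eq_one_of_formallySmooth (B := K[X][X] ⧸ Ideal.span {F ^ 2}) hF0
    Ideal.Quotient.mk_surjective (fun G => ?_) π (fun G => ?_) g (fun G => rfl) fun u => ?_
  · exact Ideal.Quotient.eq_zero_iff_mem.trans Ideal.mem_span_singleton
  · rw [hπ, AdjoinRoot.mk_eq_zero]
  · obtain ⟨w, rfl⟩ := AdjoinRoot.mk_surjective u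
    exact ⟨Ideal.Quotient.mk _ w, rfl⟩

end Bivariate

/-! ### Local parameters and ramification of `x` -/

section Ramification

variable {K L : Type*} [Field K] [Field L] [Algebra K L] {P : Place K L}

theorem aeval_mem {x : L} (hx : x ∈ P.ring) (c : K[X]) : aeval x c ∈ P.ring := by
  rw [aeval_eq_sum_range]
  refine sum_mem fun i _ => ?_
  rw [Algebra.smul_def]
  exact mul_mem (P.algebraMap_mem _) (pow_mem hx i)

theorem aevalAeval_mem {x y : L} (hx : x ∈ P.ring) (hy : y ∈ P.ring) (G : K[X][X]) :
    aevalAeval x y G ∈ P.ring := by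
  induction G using Polynomial.induction_on' with
  | add f g hf hg => rw [map_add]; exact add_mem hf hg
  | monomial n c =>
    rw [← C_mul_X_pow_eq_monomial, map_mul, map_pow, aevalAeval_C, aevalAeval_Y]
    exact mul_mem (aeval_mem hx c) (pow_mem hy n)

theorem aeval_residue {x : L} (hx : x ∈ P.ring) (c : K[X]) :
    letI := P.algebra
    aeval (IsLocalRing.residue P.ring ⟨x, hx⟩) c =
      IsLocalRing.residue P.ring ⟨aeval x c, aeval_mem hx c⟩ := by
  let := P.algebra
  have : IsScalarTower K P.ring L := IsScalarTower.of_algebraMap_eq fun _ => rfl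
  have h1 : aeval (⟨x, hx⟩ : P.ring) c = ⟨aeval x c, aeval_mem hx c⟩ := by
    apply Subtype.ext
    exact (aeval_algebraMap_apply L (⟨x, hx⟩ : P.ring) c).symm
  rw [← h1]
  exact aeval_algebraMap_apply P.ResidueField (⟨x, hx⟩ : P.ring) c

theorem isIntegral_residue_of_root {x : L} (hx : x ∈ P.ring) {c : K[X]} (hc0 : c ≠ 0)
    (hc : P.ring.valuation (aeval x c) < 1) :
    letI := P.algebra
    IsIntegral K (IsLocalRing.residue P.ring ⟨x, hx⟩) := by
  let := P.algebra
  refine IsAlgebraic.isIntegral ⟨c, hc0, ?_⟩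
  rw [aeval_residue, P.residue_eq_zero_iff]
  exact hc

theorem isIntegral_residue_of_monic {x y : L} (hx : x ∈ P.ring) (hy : y ∈ P.ring)
    {F : K[X][X]} (hF : F.Monic) (hFxy : aevalAeval x y F = 0)
    (hxi : letI := P.algebra; IsIntegral K (IsLocalRing.residue P.ring ⟨x, hx⟩)) :
    letI := P.algebra
    IsIntegral K (IsLocalRing.residue P.ring ⟨y, hy⟩) := by
  let := P.algebra
  have : IsScalarTower K P.ring L := IsScalarTower.of_algebraMap_eq fun _ => rfl
  let x' : integralClosure K P.ResidueField := ⟨IsLocalRing.residue P.ring ⟨x, hx⟩, hxi⟩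
  refine isIntegral_trans (A := integralClosure K P.ResidueField) _
    ⟨F.map (aeval x').toRingHom, hF.map _, ?_⟩
  have h1 : aevalAeval (⟨x, hx⟩ : P.ring) ⟨y, hy⟩ F = 0 := by
    apply (FaithfulSMul.algebraMap_injective P.ring L)
    rw [map_zero, ← hFxy]
    have : (IsScalarTower.toAlgHom K P.ring L).comp (aevalAeval (⟨x, hx⟩ : P.ring) ⟨y, hy⟩) =
        aevalAeval x y := algHom_ext' (by ext; simp) (by simp)
    exact DFunLike.congr_fun this F
  have h2 : ((IsScalarTower.toAlgHom K P.ring P.ResidueField).comp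
      (aevalAeval (⟨x, hx⟩ : P.ring) ⟨y, hy⟩) : K[X][X] →+* P.ResidueField) =
      eval₂RingHom ((algebraMap (integralClosure K P.ResidueField) P.ResidueField).comp
        (aeval x').toRingHom) (IsLocalRing.residue P.ring ⟨y, hy⟩) := by
    ext
    · simp
      rfl
    · simp [x']
    · simp
  have h3 := DFunLike.congr_fun h2 F
  rw [eval₂_map]
  refine h3.symm.trans ?_
  change (IsScalarTower.toAlgHom K P.ring P.ResidueField)
      (aevalAeval (⟨x, hx⟩ : P.ring) ⟨y, hy⟩ F) = 0
  rw [h1, map_zero]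

/-- A derivation which preserves the local ring and its maximal ideal induces the zero derivation
on the part of the residue field which is algebraic over the constants. -/
theorem valuation_derivation_lt_one [CharZero K] (δ : Derivation K L L)
    (hm : ∀ f, P.ring.valuation f < 1 → P.ring.valuation (δ f) < 1) {a : L} (ha : a ∈ P.ring)
    (hai : letI := P.algebra; IsIntegral K (IsLocalRing.residue P.ring ⟨a, ha⟩)) :
    P.ring.valuation (δ a) < 1 := by
  let := P.algebra
  let h := minpoly K (IsLocalRing.residue P.ring ⟨a, ha⟩)
  have h0 : P.ring.valuation (aeval a h) < 1 := by
    have := minpoly.aeval K (IsLocalRing.residue P.ring ⟨a, ha⟩)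
    rw [aeval_residue, P.residue_eq_zero_iff] at this
    exact this
  have h1 : ¬ P.ring.valuation (aeval a (derivative h)) < 1 := by
    have := (minpoly.irreducible hai).separable.aeval_derivative_ne_zero
      (minpoly.aeval K (IsLocalRing.residue P.ring ⟨a, ha⟩))
    rw [aeval_residue, Ne, P.residue_eq_zero_iff] at this
    exact this
  have h2 := hm _ h0
  rw [δ.map_aeval, smul_eq_mul, map_mul] at h2
  have h3 : P.ring.valuation (aeval a (derivative h)) = 1 :=
    le_antisymm ((P.ring.valuation_le_one_iff _).2 (aeval_mem ha _)) (not_lt.1 h1)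
  rwa [h3, one_mul] at h2

variable {z : L}

/-- If a derivation which preserves the local ring at `P` maps a local coordinate into the maximal
ideal, then it maps every function with algebraic value at `P` into the maximal ideal. -/
theorem IsLocalCoordinate.valuation_derivation_lt_one [CharZero K] (hz : IsLocalCoordinate P z)
    (δ : Derivation K L L) (hδ : ∀ f ∈ P.ring, δ f ∈ P.ring)
    (hδz : P.ring.valuation (δ z) < 1) {a : L} (ha : a ∈ P.ring)
    (hai : letI := P.algebra; IsIntegral K (IsLocalRing.residue P.ring ⟨a, ha⟩)) :
    P.ring.valuation (δ a) < 1 := by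
  refine CurveResidue.valuation_derivation_lt_one δ (fun f hf => ?_) ha hai
  obtain ⟨b, hb, rfl⟩ := hz.exists_eq_mul hf
  rw [δ.leibniz, smul_eq_mul, smul_eq_mul]
  refine Valuation.map_add_lt _ ?_ ?_
  · rw [map_mul]
    exact mul_lt_one_of_lt_of_le hz.valuation_lt_one
      ((P.ring.valuation_le_one_iff _).2 (hδ b hb))
  · rw [map_mul, mul_comm]
    exact mul_lt_one_of_lt_of_le hδz ((P.ring.valuation_le_one_iff _).2 hb)

theorem Place.valuation_natCast [CharZero K] (P : Place K L) {n : ℕ} (hn : n ≠ 0) :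
    P.ring.valuation (n : L) = 1 := by
  have := P.valuation_algebraMap (c := (n : K)) (by exact_mod_cast hn)
  rwa [map_natCast] at this

/-- If `r` has only simple roots, then `dx / r(x)` has exactly a simple pole at every point where
`r(x)` vanishes: ramification of `x` is tame in characteristic zero. -/
theorem IsLocalCoordinate.valuation_mul_deriv_div [CharZero K] [IsNoetherianRing P.ring]
    (hz : IsLocalCoordinate P z) (D : Derivation K L L) (hD : ∀ f ∈ P.ring, D f ∈ P.ring)
    (hDz : D z = 1) {x : L} (hx : x ∈ P.ring) {r : K[X]} (hr : r.Separable)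
    (hr0 : aeval x r ≠ 0) (hr1 : P.ring.valuation (aeval x r) < 1) :
    P.ring.valuation (z * D x / aeval x r) = 1 := by
  obtain ⟨n, w, hw, hw1⟩ :=
    hz.exists_eq_pow_mul ((P.ring.valuation_le_one_iff _).1 hr1.le) hr0
  have hwm : w ∈ P.ring := (P.ring.valuation_le_one_iff w).1 hw1.le
  have hn : n ≠ 0 := by
    rintro rfl
    rw [hw, pow_zero, one_mul, hw1] at hr1
    exact lt_irrefl _ hr1
  obtain ⟨m, rfl⟩ := Nat.exists_eq_succ_of_ne_zero hn
  have hr' : P.ring.valuation (aeval x (derivative r)) = 1 := by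
    obtain ⟨a, b, hab⟩ := hr
    have h1 := congrArg (aeval x) hab
    rw [map_add, map_mul, map_mul, map_one] at h1
    refine le_antisymm ((P.ring.valuation_le_one_iff _).2 (aeval_mem hx _)) (not_lt.1 fun hlt => ?_)
    have h2 : P.ring.valuation (aeval x a * aeval x r + aeval x b * aeval x (derivative r)) < 1 := by
      refine Valuation.map_add_lt _ ?_ ?_
      · rw [map_mul, mul_comm]
        exact mul_lt_one_of_lt_of_le hr1 ((P.ring.valuation_le_one_iff _).2 (aeval_mem hx _))
      · rw [map_mul, mul_comm]
        exact mul_lt_one_of_lt_of_le hlt ((P.ring.valuation_le_one_iff _).2 (aeval_mem hx _))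
    rw [h1, map_one] at h2
    exact lt_irrefl _ h2
  have h3 : aeval x (derivative r) * D x = z ^ m * ((m + 1 : ℕ) * w + z * D w) := by
    have := D.map_aeval r x
    rw [hw, D.leibniz, D.leibniz_pow, hDz] at this
    simp only [smul_eq_mul, nsmul_eq_mul, Nat.succ_eq_add_one, Nat.add_sub_cancel] at this
    rw [← this]
    ring
  have h4 : P.ring.valuation ((m + 1 : ℕ) * w + z * D w) = 1 := by
    have h5 : P.ring.valuation ((m + 1 : ℕ) * w) = 1 := by
      rw [map_mul, P.valuation_natCast m.succ_ne_zero, hw1, one_mul]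
    rw [Valuation.map_add_eq_of_lt_left, h5]
    rw [h5, map_mul]
    exact mul_lt_one_of_lt_of_le hz.valuation_lt_one
      ((P.ring.valuation_le_one_iff _).2 (hD w hwm))
  have h6 : P.ring.valuation (D x) = P.ring.valuation z ^ m := by
    have := congrArg P.ring.valuation h3
    rwa [map_mul, hr', one_mul, map_mul, h4, mul_one, map_pow] at this
  have h7 : P.ring.valuation (z * D x) = P.ring.valuation (aeval x r) := by
    rw [map_mul, h6, hw, map_mul, hw1, mul_one, map_pow, pow_succ']
  rw [map_div₀, h7, div_self]
  rwa [Ne, map_eq_zero]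

end Ramification

/-! ### The squarefree part of the discriminant -/

section Discriminant

/-- `W(k)` is a domain with residue field of characteristic `p`, in which `p ≠ 0`. -/
theorem charZero_wittVector (p : ℕ) [Fact p.Prime] (k : Type*) [Field k] [CharP k p] :
    CharZero (WittVector p k) := by
  obtain ⟨l, hl⟩ := CharP.exists (WittVector p k)
  rcases CharP.char_is_prime_or_zero (WittVector p k) l with h | rfl
  · have h1 : (l : k) = 0 := by
      have := congrArg (WittVector.constantCoeff (p := p) (R := k))
        (CharP.cast_eq_zero (WittVector p k) l)
      rwa [map_natCast, map_zero] at this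
    have h2 : p = l :=
      (Nat.prime_dvd_prime_iff_eq Fact.out h).1 ((CharP.cast_eq_zero_iff k p l).1 h1)
    exact absurd (h2 ▸ CharP.cast_eq_zero (WittVector p k) l) (WittVector.p_nonzero p k)
  · exact CharP.charP_to_charZero _

theorem irreducible_of_isDomain_adjoinRoot {R : Type*} [CommRing R] [IsDomain R] {f : R[X]}
    (hf : f ≠ 0) (h : IsDomain (AdjoinRoot f)) : Irreducible f :=
  ((Ideal.span_singleton_prime hf).1 ((Ideal.Quotient.isDomain_iff_prime _).1 h)).irreducible

/-- Write `Δ = rad(Δ) s`. Then `s` divides both `Δ` and `dΔ/dx`, hence their greatest common divisor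
`Δ / r`, so that `r` divides the radical of `Δ`. -/
theorem IsSquarefreePart.separable_map {R : Type*} [CommRing R] [IsDomain R] [IsGCDMonoid R]
    {K : Type*} [Field K] [CharZero K] [Algebra R K] [IsFractionRing R K] {Δ r : R[X]}
    (hΔ : Δ ≠ 0) (hr : IsSquarefreePart Δ r) : (r.map (algebraMap R K)).Separable := by
  classical
  let : NormalizedGCDMonoid R := Nonempty.some inferInstance
  obtain ⟨g, hg, hΔg⟩ := hr
  have hinj : Function.Injective (algebraMap R K) := IsFractionRing.injective R K
  -- a common divisor over `K` divides the greatest common divisor over `R`, by Gauss's lemma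
  have hgcd : ∀ d : K[X], d ∣ Δ.map (algebraMap R K) → d ∣ (derivative Δ).map (algebraMap R K) →
      d ∣ g.map (algebraMap R K) := by
    intro d hd1 hd2
    have hd0 : d ≠ 0 := by
      rintro rfl
      exact hΔ (map_injective _ hinj (by rw [zero_dvd_iff.1 hd1, Polynomial.map_zero]))
    let N := IsLocalization.integerNormalization (nonZeroDivisors R) d
    obtain ⟨b, hb, hN⟩ := IsLocalization.integerNormalization_spec (nonZeroDivisors R) d
    have hb0 : algebraMap R K b ≠ 0 := by
      rw [Ne, map_eq_zero_iff _ hinj]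
      exact nonZeroDivisors.ne_zero hb
    have hNd : N.map (algebraMap R K) = C (algebraMap R K b) * d := by
      rw [← smul_eq_C_mul, algebraMap_smul]
      exact hN
    have hN0 : N.content ≠ 0 := by
      rw [Ne, content_eq_zero_iff]
      intro h0
      rw [h0, Polynomial.map_zero, eq_comm, mul_eq_zero, C_eq_zero] at hNd
      exact hNd.elim hb0 hd0
    have hass : Associated (N.primPart.map (algebraMap R K)) d := by
      have h1 : Associated (N.map (algebraMap R K)) d := by
        rw [hNd]
        exact (associated_isUnit_mul_left_iff (isUnit_C.2 (isUnit_iff_ne_zero.2 hb0))).2 (.refl d)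
      rw [N.eq_C_content_mul_primPart, Polynomial.map_mul, map_C] at h1
      refine ((associated_isUnit_mul_left_iff (isUnit_C.2 (isUnit_iff_ne_zero.2 ?_))).1 h1)
      rwa [Ne, map_eq_zero_iff _ hinj]
    have hp := N.isPrimitive_primPart
    refine hass.symm.dvd.trans (Polynomial.map_dvd _ ((hg _).2 ⟨?_, ?_⟩))
    · exact hp.dvd_of_fraction_map_dvd_fraction_map (hass.dvd.trans hd1)
    · exact hp.dvd_of_fraction_map_dvd_fraction_map (hass.dvd.trans hd2)
  set Δ' := Δ.map (algebraMap R K) with hΔ'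
  have hΔ'0 : Δ' ≠ 0 := by
    rwa [hΔ', Ne, Polynomial.map_eq_zero_iff hinj]
  have h1 := hgcd (EuclideanDomain.divRadical Δ') (EuclideanDomain.divRadical_dvd_self Δ')
    (by rw [← derivative_map]; exact divRadical_dvd_derivative Δ')
  obtain ⟨c, hc⟩ := h1
  have h2 : r.map (algebraMap R K) ∣ UniqueFactorizationMonoid.radical Δ' := by
    refine ⟨c, mul_right_cancel₀ (EuclideanDomain.divRadical_ne_zero hΔ'0) ?_⟩
    rw [EuclideanDomain.radical_mul_divRadical]
    calc Δ' = r.map (algebraMap R K) * g.map (algebraMap R K) := by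
          rw [hΔ', hΔg, Polynomial.map_mul]
      _ = _ := by rw [hc]; ring
  rw [PerfectField.separable_iff_squarefree]
  exact UniqueFactorizationMonoid.squarefree_radical.squarefree_of_dvd h2

/-- An irreducible polynomial over the field `K(x)` of characteristic zero is coprime to its
derivative. -/
theorem discr_ne_zero {R : Type*} [CommRing R] [IsDomain R]
    {K : Type*} [Field K] [CharZero K] [Algebra R K] [FaithfulSMul R K] {G : R[X][X]}
    (hG : G.Monic) (hirr : Irreducible (genericFibre K G)) : G.discr ≠ 0 := by
  intro h0
  let E := FractionRing K[X]
  have : CharZero E := charZero_of_injective_algebraMap (algebraMap K E).injective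
  let φ : R[X] →+* E := (algebraMap K[X] E).comp (mapRingHom (algebraMap R K))
  have hφ : G.map φ = (genericFibre K G).map (algebraMap K[X] E) := by
    rw [genericFibre, Polynomial.map_map]
  have hmon : (genericFibre K G).Monic := hG.map _
  have hirr' : Irreducible (G.map φ) := by
    rw [hφ]
    exact hmon.irreducible_iff_irreducible_map_fraction_map.1 hirr
  have hdeg : (G.map φ).natDegree = G.natDegree := hG.natDegree_map φ
  have hpos : 0 < G.degree := by
    rw [← natDegree_pos_iff_degree_pos, ← hdeg]
    exact hirr'.natDegree_pos
  have h1 := resultant_deriv hpos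
  rw [h0, mul_zero] at h1
  have h2 := congrArg φ h1
  rw [map_zero, ← resultant_map_map, ← derivative_map, ← hdeg,
    ← natDegree_derivative, resultant_eq_zero_iff] at h2
  exact h2.2 hirr'.separable

end Discriminant

/-! ### Local rings of a smooth plane curve -/

section LocalRing

variable {K : Type*} [Field K]

/-- A prime ideal of `K[x][y]` which contains a nonzero polynomial in `x` is generated by two
elements, since it is the preimage of an ideal of the principal ideal ring `(K[x]/(π))[y]`. -/
theorem exists_eq_span_pair (M : Ideal K[X][X]) [M.IsPrime] {c : K[X]} (hc0 : c ≠ 0)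
    (hc : C c ∈ M) : ∃ u h : K[X][X], M = Ideal.span {u, h} := by
  let I : Ideal K[X] := M.comap C
  have hI0 : I ≠ ⊥ := fun h => hc0 (by
    have : c ∈ I := hc
    rwa [h] at this)
  have hIp : I.IsPrime := Ideal.comap_isPrime C M
  have hIm : I.IsMaximal := hIp.isMaximal hI0
  let : Field (K[X] ⧸ I) := Ideal.Quotient.field I
  obtain ⟨π, hπ⟩ := (IsPrincipalIdealRing.principal I).principal
  let φ : K[X][X] →+* (K[X] ⧸ I)[X] := mapRingHom (Ideal.Quotient.mk I)
  have hφ : Function.Surjective φ := map_surjective _ Ideal.Quotient.mk_surjective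
  have hker : RingHom.ker φ = Ideal.span {C π} := by
    rw [ker_mapRingHom, Ideal.mk_ker, hπ, ← Ideal.span, Ideal.map_span, Set.image_singleton]
  obtain ⟨t, ht⟩ := (IsPrincipalIdealRing.principal (M.map φ)).principal
  have htm : t ∈ M.map φ := by rw [ht]; exact Submodule.mem_span_singleton_self t
  obtain ⟨h, hhM, rfl⟩ := (Ideal.mem_map_iff_of_surjective φ hφ).1 htm
  have hπM : C π ∈ M := by
    have : π ∈ I := by rw [hπ]; exact Submodule.mem_span_singleton_self π
    exact this
  refine ⟨C π, h, le_antisymm (fun m hm => ?_) ?_⟩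
  · have h1 : φ m ∈ M.map φ := Ideal.mem_map_of_mem φ hm
    rw [ht, ← Ideal.span, Ideal.mem_span_singleton'] at h1
    obtain ⟨w, hw⟩ := h1
    obtain ⟨w, rfl⟩ := hφ w
    rw [← map_mul, eq_comm, ← sub_eq_zero, ← map_sub, ← RingHom.mem_ker, hker,
      Ideal.mem_span_singleton'] at hw
    obtain ⟨v, hv⟩ := hw
    rw [Ideal.mem_span_pair]
    exact ⟨v, w, by rw [hv]; ring⟩
  · rw [Ideal.span_le]
    rintro m (rfl | rfl)
    · exact hπM
    · exact hhM

variable {F : K[X][X]}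

/-- A smooth plane curve is regular in codimension one. Modulo `F = s u + g h`, where `u` and `h`
generate the preimage `M` of `q` in `K[x][y]`, one of the generators is a multiple of the other
locally at `q`, unless `s` and `g` both lie in `M`. -/
theorem isPrincipal_maximalIdeal_atPrime
    (hJ : ∃ a b c : K[X][X], a * derivX K F + b * derivative F + c * F = 1)
    (q : Ideal (AdjoinRoot F)) [q.IsPrime] {c : K[X]} (hc0 : c ≠ 0) (hc : AdjoinRoot.of F c ∈ q) :
    (IsLocalRing.maximalIdeal (Localization.AtPrime q)).IsPrincipal := by
  let M : Ideal K[X][X] := q.comap (AdjoinRoot.mk F)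
  have hMp : M.IsPrime := Ideal.comap_isPrime _ q
  obtain ⟨u, h, hM⟩ := exists_eq_span_pair M hc0 (show AdjoinRoot.mk F (C c) ∈ q from hc)
  have huM : u ∈ M := hM ▸ Ideal.subset_span (by simp)
  have hhM : h ∈ M := hM ▸ Ideal.subset_span (by simp)
  have hFM : F ∈ M := by
    change AdjoinRoot.mk F F ∈ q
    rw [AdjoinRoot.mk_self]
    exact q.zero_mem
  have hFM' := hFM
  rw [hM, Ideal.mem_span_pair] at hFM'
  obtain ⟨s, g, hsg⟩ := hFM'
  -- otherwise `F ∈ M²`, and its partial derivatives vanish modulo `M`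
  have hnot : s ∉ M ∨ g ∉ M := by
    by_contra! hcon
    obtain ⟨a, b, c, habc⟩ := hJ
    refine hMp.ne_top ((Ideal.eq_top_iff_one M).2 ?_)
    rw [← habc, ← hsg, map_add, map_add, Derivation.leibniz, Derivation.leibniz, derivative_mul,
      derivative_mul, hsg]
    simp only [smul_eq_mul]
    refine add_mem (add_mem (M.mul_mem_left _ (add_mem (add_mem ?_ ?_) (add_mem ?_ ?_)))
      (M.mul_mem_left _ (add_mem (add_mem ?_ ?_) (add_mem ?_ ?_)))) (M.mul_mem_left _ hFM)
    · exact M.mul_mem_right _ hcon.1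
    · exact M.mul_mem_right _ huM
    · exact M.mul_mem_right _ hcon.2
    · exact M.mul_mem_right _ hhM
    · exact M.mul_mem_left _ huM
    · exact M.mul_mem_right _ hcon.1
    · exact M.mul_mem_left _ hhM
    · exact M.mul_mem_right _ hcon.2
  let θ : K[X][X] →+* Localization.AtPrime q := (algebraMap _ _).comp (AdjoinRoot.mk F)
  have hθu : ∀ w, w ∉ M → IsUnit (θ w) := fun w hw =>
    IsLocalization.map_units (M := q.primeCompl) (Localization.AtPrime q) ⟨AdjoinRoot.mk F w, hw⟩
  have hmax : IsLocalRing.maximalIdeal (Localization.AtPrime q) = Ideal.span {θ u, θ h} := by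
    have hMq : M.map (AdjoinRoot.mk F) = q :=
      Ideal.map_comap_of_surjective _ AdjoinRoot.mk_surjective q
    have hMθ : M.map θ = q.map (algebraMap _ _) :=
      (Ideal.map_map (AdjoinRoot.mk F) (algebraMap _ (Localization.AtPrime q))).symm.trans
        (congrArg _ hMq)
    rw [← Localization.AtPrime.map_eq_maximalIdeal, ← hMθ, hM, Ideal.map_span, Set.image_pair]
  have hrel : θ s * θ u + θ g * θ h = 0 := by
    rw [← map_mul, ← map_mul, ← map_add, hsg]
    simp [θ]
  rcases hnot with hs | hg
  · obtain ⟨s', hs'⟩ := (hθu s hs).exists_left_inv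
    refine ⟨θ h, ?_⟩
    rw [hmax, ← Ideal.span]
    refine Ideal.span_pair_eq_span_right_iff_dvd.2 ⟨-s' * θ g, ?_⟩
    linear_combination (-θ u) * hs' + s' * hrel
  · obtain ⟨g', hg'⟩ := (hθu g hg).exists_left_inv
    refine ⟨θ u, ?_⟩
    rw [hmax, ← Ideal.span]
    refine Ideal.span_pair_eq_span_left_iff_dvd.2 ⟨-g' * θ s, ?_⟩
    linear_combination (-θ h) * hg' + g' * hrel

variable {L : Type*} [Field L] [Algebra (AdjoinRoot F) L] [Algebra K L]

/-- The prime ideal of the functions on the affine curve which vanish at `P`. -/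
def Place.center (P : Place K L) (hP : ∀ a : AdjoinRoot F, algebraMap (AdjoinRoot F) L a ∈ P.ring) :
    Ideal (AdjoinRoot F) :=
  (IsLocalRing.maximalIdeal P.ring).comap
    ((algebraMap (AdjoinRoot F) L).codRestrict P.ring.toSubring hP)

theorem Place.mem_center (P : Place K L)
    (hP : ∀ a : AdjoinRoot F, algebraMap (AdjoinRoot F) L a ∈ P.ring) (a : AdjoinRoot F) :
    a ∈ P.center hP ↔ P.ring.valuation (algebraMap (AdjoinRoot F) L a) < 1 :=
  P.ring.valuation_lt_one_iff ⟨algebraMap (AdjoinRoot F) L a, hP a⟩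

theorem Place.isPrime_center (P : Place K L)
    (hP : ∀ a : AdjoinRoot F, algebraMap (AdjoinRoot F) L a ∈ P.ring) : (P.center hP).IsPrime :=
  Ideal.comap_isPrime _ _

theorem Place.valuation_eq_one_of_notMem_center (P : Place K L)
    (hP : ∀ a : AdjoinRoot F, algebraMap (AdjoinRoot F) L a ∈ P.ring) {a : AdjoinRoot F}
    (ha : a ∉ P.center hP) : P.ring.valuation (algebraMap (AdjoinRoot F) L a) = 1 := by
  rw [P.mem_center] at ha
  exact le_antisymm ((P.ring.valuation_le_one_iff _).2 (hP a)) (not_lt.1 ha)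

variable [IsFractionRing (AdjoinRoot F) L]

/-- The local ring at a point `P` of a smooth affine plane curve is the localization of the
coordinate ring: that localization is already a valuation ring, and valuation rings are maximal
for domination. -/
theorem Place.exists_eq_div (P : Place K L)
    (hP : ∀ a : AdjoinRoot F, algebraMap (AdjoinRoot F) L a ∈ P.ring)
    (hJ : ∃ a b c : K[X][X], a * derivX K F + b * derivative F + c * F = 1)
    {c : K[X]} (hc0 : c ≠ 0) (hc : AdjoinRoot.of F c ∈ P.center hP) {f : L} (hf : f ∈ P.ring) :
    ∃ a b : AdjoinRoot F, b ∉ P.center hP ∧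
      f = algebraMap (AdjoinRoot F) L a / algebraMap (AdjoinRoot F) L b := by
  have hprime := P.isPrime_center hP
  have hinj : Function.Injective (algebraMap (AdjoinRoot F) L) := IsFractionRing.injective _ _
  have hdom : IsDomain (AdjoinRoot F) := hinj.isDomain
  let Loc := Localization.AtPrime (P.center hP)
  have hlocinj : Function.Injective (algebraMap (AdjoinRoot F) Loc) :=
    IsLocalization.injective _ (P.center hP).primeCompl_le_nonZeroDivisors
  have : IsNoetherianRing Loc :=
    IsLocalization.isNoetherianRing (P.center hP).primeCompl _ inferInstance
  have : IsDomain Loc :=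
    IsLocalization.isDomain_localization (P.center hP).primeCompl_le_nonZeroDivisors
  have hval : ValuationRing Loc :=
    ((tfae_of_isNoetherianRing_of_isLocalRing_of_isDomain Loc).out 4 1).1
      (isPrincipal_maximalIdeal_atPrime hJ (P.center hP) hc0 hc)
  -- divisibility in the localization, with denominators cleared
  have hdvd : ∀ a b : AdjoinRoot F, algebraMap _ Loc a ∣ algebraMap _ Loc b →
      ∃ w s, s ∉ P.center hP ∧ b * s = a * w := by
    rintro a b ⟨t, ht⟩
    obtain ⟨⟨w, s⟩, hws⟩ := IsLocalization.surj (P.center hP).primeCompl t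
    refine ⟨w, s, s.2, hlocinj ?_⟩
    rw [map_mul, map_mul, ← hws, ht]
    ring
  obtain ⟨a, b, hb, rfl⟩ := IsFractionRing.div_surjective (A := AdjoinRoot F) f
  have hb0 : algebraMap (AdjoinRoot F) L b ≠ 0 := by
    rw [Ne, map_eq_zero_iff _ hinj]
    exact nonZeroDivisors.ne_zero hb
  have hs0 : ∀ s, s ∉ P.center hP → algebraMap (AdjoinRoot F) L s ≠ 0 := fun s hs h0 => by
    have := P.valuation_eq_one_of_notMem_center hP hs
    rw [h0, map_zero] at this
    exact zero_ne_one this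
  by_cases ha : a = 0
  · refine ⟨0, 1, fun h1 => hprime.ne_top ((Ideal.eq_top_iff_one _).2 h1), ?_⟩
    rw [ha, map_zero, zero_div, zero_div]
  have ha0 : algebraMap (AdjoinRoot F) L a ≠ 0 := by
    rwa [Ne, map_eq_zero_iff _ hinj]
  rcases ValuationRing.dvd_total (algebraMap _ Loc a) (algebraMap _ Loc b) with h | h
  · obtain ⟨w, s, hs, hws⟩ := hdvd a b h
    have h1 := congrArg (algebraMap (AdjoinRoot F) L) hws
    rw [map_mul, map_mul] at h1
    have hw0 : algebraMap (AdjoinRoot F) L w ≠ 0 := by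
      intro hw
      rw [hw, mul_zero] at h1
      exact (mul_ne_zero hb0 (hs0 s hs)) h1
    have h2 : algebraMap (AdjoinRoot F) L a / algebraMap (AdjoinRoot F) L b =
        algebraMap (AdjoinRoot F) L s / algebraMap (AdjoinRoot F) L w := by
      rw [div_eq_div_iff hb0 hw0, ← h1, mul_comm]
    refine ⟨s, w, fun hw => ?_, h2⟩
    rw [P.mem_center] at hw
    rw [h2, ← P.ring.valuation_le_one_iff, map_div₀, P.valuation_eq_one_of_notMem_center hP hs,
      one_div] at hf
    have hpos : (0 : P.ring.ValueGroup) <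
        P.ring.valuation (algebraMap (AdjoinRoot F) L w) := (Valuation.pos_iff _).2 hw0
    exact absurd ((one_lt_inv₀ hpos).2 hw) (not_lt.2 hf)
  · obtain ⟨w, s, hs, hws⟩ := hdvd b a h
    refine ⟨w, s, hs, ?_⟩
    rw [div_eq_div_iff hb0 (hs0 s hs), ← map_mul, ← map_mul, hws, mul_comm]

theorem Place.isNoetherianRing (P : Place K L)
    (hP : ∀ a : AdjoinRoot F, algebraMap (AdjoinRoot F) L a ∈ P.ring)
    (hJ : ∃ a b c : K[X][X], a * derivX K F + b * derivative F + c * F = 1)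
    {c : K[X]} (hc0 : c ≠ 0) (hc : AdjoinRoot.of F c ∈ P.center hP) :
    IsNoetherianRing P.ring := by
  have hprime := P.isPrime_center hP
  let ψ : AdjoinRoot F →+* P.ring :=
    (algebraMap (AdjoinRoot F) L).codRestrict P.ring.toSubring hP
  have hψ : ∀ s : (P.center hP).primeCompl, IsUnit (ψ s) := fun s =>
    (P.ring.valuation_eq_one_iff _).2 (P.valuation_eq_one_of_notMem_center hP s.2)
  have : IsNoetherianRing (Localization.AtPrime (P.center hP)) :=
    IsLocalization.isNoetherianRing (P.center hP).primeCompl _ inferInstance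
  refine isNoetherianRing_of_surjective (Localization.AtPrime (P.center hP)) P.ring
    (IsLocalization.lift hψ) fun f => ?_
  obtain ⟨a, b, hb, hf⟩ := P.exists_eq_div hP hJ hc0 hc f.2
  have hb1 := P.valuation_eq_one_of_notMem_center hP hb
  refine ⟨IsLocalization.mk' _ a (⟨b, hb⟩ : (P.center hP).primeCompl), ?_⟩
  rw [IsLocalization.lift_mk'_spec]
  apply Subtype.ext
  change algebraMap (AdjoinRoot F) L a = algebraMap (AdjoinRoot F) L b * f
  rw [hf, mul_div_cancel₀]
  intro h0
  rw [h0, map_zero] at hb1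
  exact zero_ne_one hb1

theorem Place.derivation_mem (P : Place K L)
    (hP : ∀ a : AdjoinRoot F, algebraMap (AdjoinRoot F) L a ∈ P.ring)
    (hJ : ∃ a b c : K[X][X], a * derivX K F + b * derivative F + c * F = 1)
    {c : K[X]} (hc0 : c ≠ 0) (hc : AdjoinRoot.of F c ∈ P.center hP) (δ : Derivation K L L)
    (hδ : ∀ a : AdjoinRoot F, δ (algebraMap (AdjoinRoot F) L a) ∈ P.ring) {f : L}
    (hf : f ∈ P.ring) : δ f ∈ P.ring := by
  obtain ⟨a, b, hb, rfl⟩ := P.exists_eq_div hP hJ hc0 hc hf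
  have hb1 := P.valuation_eq_one_of_notMem_center hP hb
  have hbi : (algebraMap (AdjoinRoot F) L b)⁻¹ ∈ P.ring := by
    rw [← P.ring.valuation_le_one_iff, map_inv₀, hb1, inv_one]
  rw [Derivation.leibniz_div, smul_eq_mul, sq, smul_eq_mul, smul_eq_mul]
  exact mul_mem (mul_mem hbi hbi)
    (sub_mem (mul_mem (hP b) (hδ a)) (mul_mem (hP a) (hδ b)))

end LocalRing

/-! ### Differentiation with respect to `x` -/

section Differentiation

variable {K : Type*} [Field K]

theorem _root_.Polynomial.Monic.degree_ne_zero_of_nontrivial_adjoinRoot {R : Type*} [CommRing R]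
    {f : R[X]} (hf : f.Monic) [Nontrivial (AdjoinRoot f)] : f.degree ≠ 0 := fun h => by
  have h1 : f = 1 := eq_one_of_monic_natDegree_zero hf (natDegree_eq_of_degree_eq_some h)
  have h2 : AdjoinRoot.mk f 1 = 0 := AdjoinRoot.mk_eq_zero.2 (h1 ▸ dvd_rfl)
  rw [map_one] at h2
  exact one_ne_zero h2

/-- If `L` is formally étale over `K[x]`, then `Ω[L/K]` is free on `dx`. -/
theorem exists_derivation_of_formallyEtale {L : Type*} [Field L] [Algebra K L] [Algebra K[X] L]
    [IsScalarTower K K[X] L] [Algebra.FormallyEtale K[X] L] :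
    ∃ d : Derivation K L L, d (algebraMap K[X] L X) = 1 ∧
      ∀ f, KaehlerDifferential.D K L f =
        d f • KaehlerDifferential.D K L (algebraMap K[X] L X) := by
  let e : Ω[L⁄K] ≃ₗ[L] L :=
    (KaehlerDifferential.tensorKaehlerEquivOfFormallyEtale K K[X] L).symm ≪≫ₗ
      TensorProduct.AlgebraTensorModule.congr (LinearEquiv.refl L L)
        (KaehlerDifferential.polynomialEquiv K) ≪≫ₗ
      TensorProduct.AlgebraTensorModule.rid K[X] L L
  have hx : e (KaehlerDifferential.D K L (algebraMap K[X] L X)) = 1 := by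
    simp [e, KaehlerDifferential.tensorKaehlerEquivOfFormallyEtale_symm_D_algebraMap]
  refine ⟨e.toLinearMap.compDer (KaehlerDifferential.D K L), hx, fun f => e.injective ?_⟩
  rw [map_smul, hx, smul_eq_mul, mul_one]
  rfl

variable (F : K[X][X]) (L : Type*) [Field L] [Algebra (AdjoinRoot F) L]
variable [IsFractionRing (AdjoinRoot F) L] [Algebra K L] [IsScalarTower K (AdjoinRoot F) L]

/-- In characteristic zero, the function field `K(x, y)` is separable over `K(x)`, so that `d/dx`
extends to it and `dx` generates its differentials. -/
theorem exists_derivation_xFun [CharZero K] (hF : F.Monic) :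
    ∃ d : Derivation K L L, d (xFun F L) = 1 ∧
      ∀ f, KaehlerDifferential.D K L f = d f • KaehlerDifferential.D K L (xFun F L) := by
  let : Algebra K[X] L := ((algebraMap (AdjoinRoot F) L).comp (AdjoinRoot.of F)).toAlgebra
  have : IsScalarTower K[X] (AdjoinRoot F) L := IsScalarTower.of_algebraMap_eq fun _ => rfl
  have : IsScalarTower K K[X] L := IsScalarTower.of_algebraMap_eq fun c => by
    rw [IsScalarTower.algebraMap_apply K (AdjoinRoot F) L,
      IsScalarTower.algebraMap_apply K K[X] (AdjoinRoot F)]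
    rfl
  have hinj : Function.Injective (algebraMap (AdjoinRoot F) L) := IsFractionRing.injective _ _
  have hdom : IsDomain (AdjoinRoot F) := hinj.isDomain
  have hdeg := hF.degree_ne_zero_of_nontrivial_adjoinRoot
  have : FaithfulSMul K[X] L := by
    rw [faithfulSMul_iff_algebraMap_injective]
    exact hinj.comp (AdjoinRoot.of.injective_of_degree_ne_zero hdeg)
  let := FractionRing.liftAlgebra K[X] L
  have : CharZero (FractionRing K[X]) :=
    charZero_of_injective_algebraMap (algebraMap K (FractionRing K[X])).injective
  have : Module.Finite K[X] (AdjoinRoot F) := hF.finite_adjoinRoot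
  have : Algebra.IsAlgebraic (AdjoinRoot F) L := 
    IsLocalization.isAlgebraic L (nonZeroDivisors (AdjoinRoot F))
  have : Algebra.IsAlgebraic K[X] L := Algebra.IsAlgebraic.trans K[X] (AdjoinRoot F) L
  have : Algebra.IsAlgebraic (FractionRing K[X]) L :=
    Algebra.IsAlgebraic.extendScalars (IsFractionRing.injective K[X] (FractionRing K[X]))
  have : Algebra.FormallyEtale K[X] (FractionRing K[X]) :=
    Algebra.FormallyEtale.of_isLocalization (nonZeroDivisors K[X])
  have : Algebra.FormallyEtale (FractionRing K[X]) L := Algebra.FormallyEtale.of_isSeparable _ _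
  have : Algebra.FormallyEtale K[X] L := Algebra.FormallyEtale.comp K[X] (FractionRing K[X]) L
  exact exists_derivation_of_formallyEtale

end Differentiation

/-! ### The residue condition at one point -/

section Local

variable {K : Type*} [Field K] {F : K[X][X]} {L : Type*} [Field L] [Algebra (AdjoinRoot F) L]
theorem ofX_ne_zero [IsFractionRing (AdjoinRoot F) L] (hF : F.Monic) {c : K[X]} (hc : c ≠ 0) :
    ofX F L c ≠ 0 := by
  have hinj : Function.Injective (algebraMap (AdjoinRoot F) L) := IsFractionRing.injective _ _
  have hdom : IsDomain (AdjoinRoot F) := hinj.isDomain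
  have hdeg := hF.degree_ne_zero_of_nontrivial_adjoinRoot
  rw [ofX, Ne, map_eq_zero_iff _ hinj,
    map_eq_zero_iff _ (AdjoinRoot.of.injective_of_degree_ne_zero hdeg)]
  exact hc

variable [Algebra K L] [IsScalarTower K (AdjoinRoot F) L]

theorem algebraMap_mk_eq_aevalAeval (G : K[X][X]) :
    algebraMap (AdjoinRoot F) L (AdjoinRoot.mk F G) = aevalAeval (xFun F L) (yFun F L) G := by
  have h : (IsScalarTower.toAlgHom K (AdjoinRoot F) L).comp
      ((AdjoinRoot.mkₐ F).restrictScalars K) = aevalAeval (xFun F L) (yFun F L) :=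
    algHom_ext' (by ext; simp; rfl) (by simp; rfl)
  exact DFunLike.congr_fun h G

theorem ofX_eq_aeval (c : K[X]) : ofX F L c = aeval (xFun F L) c :=
  (algebraMap_mk_eq_aevalAeval (C c)).trans (aevalAeval_C _ _ c)

variable [IsFractionRing (AdjoinRoot F) L]

/-- At a point `P` over a simple root of `r`, both the vanishing of the residue of `S dx / r` and
the divisibility of `F_y S` by `r` say that `S` vanishes at `P`. The derivation `δ` with
`δ x = F_y`, `δ y = -F_x` maps a local coordinate `z` to a unit, because `F_x` and `F_y` do not
both vanish at `P`; hence `dx / dz = F_y / δ z` has the same order at `P` as `F_y`, which is one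
less than the order of `r`. -/
theorem hasResidue_zero_iff_and_mem_iff [CharZero K] (hF : F.Monic)
    (hJ : ∃ a b c : K[X][X], a * derivX K F + b * derivative F + c * F = 1) {P : Place K L} {z : L}
    (hz : IsLocalCoordinate P z) (hx : xFun F L ∈ P.ring) {r : K[X]} (hr : r.Separable)
    (hr1 : P.ring.valuation (ofX F L r) < 1) {S : L} (hS : S ∈ P.ring) :
    (HasResidue P z ((S / ofX F L r) • KaehlerDifferential.D K L (xFun F L)) 0 ↔
        P.ring.valuation S < 1) ∧
      (algebraMap (AdjoinRoot F) L (AdjoinRoot.mk F (derivative F)) * S / ofX F L r ∈ P.ring ↔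
        P.ring.valuation S < 1) := by
  have hP : ∀ a : AdjoinRoot F, algebraMap (AdjoinRoot F) L a ∈ P.ring := fun a =>
    algebraMap_mem_regular L hF a P hx
  have hr0 : ofX F L r ≠ 0 := ofX_ne_zero hF hr.ne_zero
  have hc : AdjoinRoot.of F r ∈ P.center hP := (P.mem_center hP _).2 hr1
  have := P.isNoetherianRing hP hJ hr.ne_zero hc
  obtain ⟨d, hdx, hd⟩ := exists_derivation_xFun F L hF
  have hy : yFun F L ∈ P.ring := hP _
  have hFxy : aevalAeval (xFun F L) (yFun F L) F = 0 := by
    rw [← algebraMap_mk_eq_aevalAeval, AdjoinRoot.mk_self, map_zero]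
  rw [algebraMap_mk_eq_aevalAeval]
  set Fx := aevalAeval (xFun F L) (yFun F L) (derivX K F) with hFx
  set Fy := aevalAeval (xFun F L) (yFun F L) (derivative F) with hFy
  have hdy : Fy * d (yFun F L) = -Fx := by
    have h1 := derivation_aevalAeval d (xFun F L) (yFun F L) F
    rw [hFxy, map_zero, hdx, smul_eq_mul, smul_eq_mul, mul_one, ← hFx, ← hFy] at h1
    linear_combination -h1
  let δ : Derivation K L L := Fy • d
  have hδ_def : ∀ f, δ f = Fy * d f := fun f => rfl
  have hδA : ∀ a : AdjoinRoot F, δ (algebraMap (AdjoinRoot F) L a) ∈ P.ring := by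
    intro a
    obtain ⟨G, rfl⟩ := AdjoinRoot.mk_surjective a
    have h1 : δ (algebraMap (AdjoinRoot F) L (AdjoinRoot.mk F G)) =
        Fy * aevalAeval (xFun F L) (yFun F L) (derivX K G) -
          Fx * aevalAeval (xFun F L) (yFun F L) (derivative G) := by
      rw [hδ_def, algebraMap_mk_eq_aevalAeval, derivation_aevalAeval, hdx, smul_eq_mul,
        smul_eq_mul]
      linear_combination (aevalAeval (xFun F L) (yFun F L) (derivative G)) * hdy
    rw [h1]
    exact sub_mem (mul_mem (aevalAeval_mem hx hy _) (aevalAeval_mem hx hy _))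
      (mul_mem (aevalAeval_mem hx hy _) (aevalAeval_mem hx hy _))
  have hδ : ∀ f ∈ P.ring, δ f ∈ P.ring := fun f hf =>
    P.derivation_mem hP hJ hr.ne_zero hc δ hδA hf
  have hzm : z ∈ P.ring := hz.choose
  have hδz : P.ring.valuation (δ z) = 1 := by
    refine le_antisymm ((P.ring.valuation_le_one_iff _).2 (hδ z hzm)) (not_lt.1 fun hlt => ?_)
    have hxi := isIntegral_residue_of_root hx hr.ne_zero (by rwa [← ofX_eq_aeval])
    have h1 := hz.valuation_derivation_lt_one δ hδ hlt hx hxi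
    have h2 := hz.valuation_derivation_lt_one δ hδ hlt hy
      (isIntegral_residue_of_monic hx hy hF hFxy hxi)
    rw [hδ_def, hdx, mul_one] at h1
    rw [hδ_def, hdy, Valuation.map_neg] at h2
    obtain ⟨a, b, c, habc⟩ := hJ
    have h3 := congrArg (aevalAeval (xFun F L) (yFun F L)) habc
    rw [map_add, map_add, map_mul, map_mul, map_mul, hFxy, mul_zero, add_zero, map_one, ← hFx,
      ← hFy] at h3
    have h4 : P.ring.valuation (aevalAeval (xFun F L) (yFun F L) a * Fx +
        aevalAeval (xFun F L) (yFun F L) b * Fy) < 1 := by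
      refine Valuation.map_add_lt _ ?_ ?_
      · rw [map_mul, mul_comm]
        exact mul_lt_one_of_lt_of_le h2
          ((P.ring.valuation_le_one_iff _).2 (aevalAeval_mem hx hy _))
      · rw [map_mul, mul_comm]
        exact mul_lt_one_of_lt_of_le h1
          ((P.ring.valuation_le_one_iff _).2 (aevalAeval_mem hx hy _))
    rw [h3, map_one] at h4
    exact lt_irrefl _ h4
  have hδz0 : δ z ≠ 0 := fun h0 => by
    rw [h0, map_zero] at hδz
    exact zero_ne_one hδz
  let D : Derivation K L L := (δ z)⁻¹ • δ
  have hD_def : ∀ f, D f = (δ z)⁻¹ * δ f := fun f => rfl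
  have hDz : D z = 1 := by rw [hD_def, inv_mul_cancel₀ hδz0]
  have hD : ∀ f ∈ P.ring, D f ∈ P.ring := fun f hf => by
    rw [hD_def]
    refine mul_mem ?_ (hδ f hf)
    rw [← P.ring.valuation_le_one_iff, map_inv₀, hδz, inv_one]
  have hDx : D (xFun F L) = (δ z)⁻¹ * Fy := by
    rw [hD_def, hδ_def (xFun F L), hdx, mul_one]
  have hdz0 : d z ≠ 0 := fun h0 => hδz0 (by rw [hδ_def, h0, mul_zero])
  have hFy0 : Fy ≠ 0 := fun h0 => hδz0 (by rw [hδ_def, h0, zero_mul])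
  have hdxdz : KaehlerDifferential.D K L (xFun F L) =
      D (xFun F L) • KaehlerDifferential.D K L z := by
    rw [hd z, smul_smul, hDx, hδ_def z]
    have : (Fy * d z)⁻¹ * Fy * d z = 1 := by field_simp
    rw [this, one_smul]
  have hkey := hz.valuation_mul_deriv_div D hD hDz hx hr (by rwa [← ofX_eq_aeval])
    (by rwa [← ofX_eq_aeval])
  rw [← ofX_eq_aeval] at hkey
  have hvz : P.ring.valuation z ≠ 0 := by
    rw [Ne, map_eq_zero]
    rintro rfl
    rw [map_zero] at hDz
    exact zero_ne_one hDz
  constructor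
  · have h1 : z * (S / ofX F L r * D (xFun F L)) = S * (z * D (xFun F L) / ofX F L r) := by
      ring
    have h2 : P.ring.valuation (z * (S / ofX F L r * D (xFun F L))) = P.ring.valuation S := by
      rw [h1, map_mul, hkey, mul_one]
    rw [hdxdz, smul_smul, hasResidue_zero_iff hz D hD hDz, h2]
    rw [← P.ring.valuation_le_one_iff, h2]
    exact (P.ring.valuation_le_one_iff S).2 hS
  · have h1 : P.ring.valuation (Fy * S / ofX F L r) * P.ring.valuation z =
        P.ring.valuation S := by
      have h2 : Fy * S / ofX F L r * z = δ z * S * (z * D (xFun F L) / ofX F L r) := by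
        rw [hDx]
        field_simp
      rw [← map_mul, h2, map_mul, map_mul, hkey, hδz, one_mul, mul_one]
    rw [← P.ring.valuation_le_one_iff, hz.valuation_lt_one_iff, ← h1]
    exact (mul_le_iff_le_one_left (zero_lt_iff.2 hvz)).symm

theorem liesOnU_iff (hF : F.Monic) {P : Place K L} (hx : xFun F L ∈ P.ring) {r : K[X]}
    (hr : r ≠ 0) : LiesOnU F L r P ↔ P.ring.valuation (ofX F L r) = 1 := by
  have hr0 : ofX F L r ≠ 0 := ofX_ne_zero hF hr
  have hle := (P.ring.valuation_le_one_iff _).2 (ofX_mem F L P hx r)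
  have hpos : 0 < P.ring.valuation (ofX F L r) := (Valuation.pos_iff _).2 hr0
  have hinv : (ofX F L r)⁻¹ ∈ P.ring ↔ P.ring.valuation (ofX F L r) = 1 := by
    rw [← P.ring.valuation_le_one_iff, map_inv₀, inv_le_one₀ hpos]
    exact ⟨fun h => le_antisymm hle h, fun h => h.ge⟩
  rw [← hinv]
  refine ⟨fun h => h _ (Algebra.subset_adjoin (by simp)), fun h f hf => ?_⟩
  induction hf using Algebra.adjoin_induction with
  | mem f hf =>
    rcases hf with rfl | rfl | rfl
    · exact hx
    · exact h
    · exact yFun_mem L hF P hx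
  | algebraMap c => exact P.algebraMap_mem c
  | add f g _ _ hf hg => exact add_mem hf hg
  | mul f g _ _ hf hg => exact mul_mem hf hg

/-- The residue criterion for a smooth plane curve over a field of characteristic zero, with an
arbitrary separable denominator `r` and an arbitrary numerator `a` in the coordinate ring. -/
theorem forall_hasResidue_zero_iff [CharZero K] (hF : F.Monic)
    (hsmooth : Algebra.Smooth K (AdjoinRoot F)) {r : K[X]} (hr : r.Separable) (z : Place K L → L)
    (hz : ∀ P : Place K L, ¬ LiesOnU F L r P → IsLocalCoordinate P (z P)) (a : AdjoinRoot F) :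
    (∀ P : Place K L, ¬ LiesOnU F L r P → xFun F L ∈ P.ring →
        HasResidue P (z P) ((algebraMap (AdjoinRoot F) L a / ofX F L r) •
          KaehlerDifferential.D K L (xFun F L)) 0) ↔
      Ideal.Quotient.mk (Ideal.span {toRegular L hF (AdjoinRoot.of F r)})
        (toRegular L hF (AdjoinRoot.mk F (derivative F) * a)) = 0 := by
  have hJ := exists_jacobian_eq_one_of_smooth F hF.ne_zero hsmooth
  have hr0 : ofX F L r ≠ 0 := ofX_ne_zero hF hr.ne_zero
  set S := algebraMap (AdjoinRoot F) L a with hS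
  set Fy := algebraMap (AdjoinRoot F) L (AdjoinRoot.mk F (derivative F)) with hFy
  have hmem : ∀ P : Place K L, xFun F L ∈ P.ring → ∀ b, algebraMap (AdjoinRoot F) L b ∈ P.ring :=
    fun P hx b => algebraMap_mem_regular L hF b P hx
  have hdvd : Ideal.Quotient.mk (Ideal.span {toRegular L hF (AdjoinRoot.of F r)})
        (toRegular L hF (AdjoinRoot.mk F (derivative F) * a)) = 0 ↔
      Fy * S / ofX F L r ∈ regularAwayFromInfinity K (xFun F L) := by
    rw [Ideal.Quotient.eq_zero_iff_mem, Ideal.mem_span_singleton']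
    constructor
    · rintro ⟨g, hg⟩
      have h1 : (g : L) * ofX F L r = Fy * S :=
        (congrArg Subtype.val hg).trans (map_mul (algebraMap (AdjoinRoot F) L) _ _)
      rw [← h1, mul_div_cancel_right₀ _ hr0]
      exact g.2
    · intro h
      refine ⟨⟨_, h⟩, Subtype.ext ?_⟩
      refine (div_mul_cancel₀ (Fy * S) hr0).trans ?_
      exact (map_mul (algebraMap (AdjoinRoot F) L) _ _).symm
  have hlt : ∀ P : Place K L, ¬ LiesOnU F L r P → xFun F L ∈ P.ring →
      P.ring.valuation (ofX F L r) < 1 := fun P hP hx => by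
    rw [liesOnU_iff hF hx hr.ne_zero] at hP
    exact lt_of_le_of_ne ((P.ring.valuation_le_one_iff _).2 (ofX_mem F L P hx r)) hP
  rw [hdvd]
  constructor
  · intro h P hx
    by_cases hP : LiesOnU F L r P
    · have hinv : (ofX F L r)⁻¹ ∈ P.ring := hP _ (Algebra.subset_adjoin (by simp))
      rw [div_eq_mul_inv]
      exact mul_mem (mul_mem (hmem P hx _) (hmem P hx _)) hinv
    · have := hasResidue_zero_iff_and_mem_iff hF hJ (hz P hP) hx hr (hlt P hP hx) (hmem P hx a)
      exact this.2.2 (this.1.1 (h P hP hx))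
  · intro h P hP hx
    have := hasResidue_zero_iff_and_mem_iff hF hJ (hz P hP) hx hr (hlt P hP hx) (hmem P hx a)
    exact this.1.2 (this.2.1 (h P hx))

end Local

end

end CurveResidue

theorem mainTheorem11
    -- the finite field `𝔽_q` and the field `ℚ_q`, the fraction field of `ℤ_q = W(𝔽_q)`
    (p : ℕ) [Fact p.Prime] (k : Type*) [Field k] [Finite k] [CharP k p]
    (K : Type*) [Field K] [Algebra (WittVector p k) K] [IsFractionRing (WittVector p k) K]
    -- the curve over `𝔽_q`, and the lift of its equation
    (Q : k[X][X]) (hQirr : Irreducible Q) (hQmonic : Q.Monic)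
    (hQsep : (Q.map (algebraMap k[X] (RatFunc k))).Separable)
    (𝒬 : (WittVector p k)[X][X]) (h𝒬 : CurveResidue.IsGoodLift Q 𝒬)
    -- the zero locus of `𝒬` in the affine plane over `ℚ_q` is smooth
    (hsmooth : Algebra.Smooth K (AdjoinRoot (CurveResidue.genericFibre K 𝒬)))
    (r : (WittVector p k)[X]) (hr : CurveResidue.IsSquarefreePart 𝒬.discr r)
    -- the function field `ℚ_q(x, y)`
    (L : Type*) [Field L] [Algebra K L] [Algebra (AdjoinRoot (CurveResidue.genericFibre K 𝒬)) L]
    [IsScalarTower K (AdjoinRoot (CurveResidue.genericFibre K 𝒬)) L]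
    [IsFractionRing (AdjoinRoot (CurveResidue.genericFibre K 𝒬)) L]
    -- a local coordinate at each point outside `𝕌`
    (z : CurveResidue.Place K L → L)
    (hz : ∀ P : CurveResidue.Place K L,
      ¬ CurveResidue.LiesOnU (CurveResidue.genericFibre K 𝒬) L (r.map (algebraMap _ K)) P →
        CurveResidue.IsLocalCoordinate P (z P))
    (u : Fin Q.natDegree → K[X]) (ω : Ω[L⁄K])
    (hω : ω = ((∑ i, CurveResidue.ofX (CurveResidue.genericFibre K 𝒬) L (u i) *
          CurveResidue.yFun (CurveResidue.genericFibre K 𝒬) L ^ (i : ℕ)) /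
        CurveResidue.ofX (CurveResidue.genericFibre K 𝒬) L (r.map (algebraMap _ K))) •
      KaehlerDifferential.D K L (CurveResidue.xFun (CurveResidue.genericFibre K 𝒬) L)) :
    (∀ P : CurveResidue.Place K L,
      ¬ CurveResidue.LiesOnU (CurveResidue.genericFibre K 𝒬) L (r.map (algebraMap _ K)) P →
        CurveResidue.xFun (CurveResidue.genericFibre K 𝒬) L ∈ P.ring →
          CurveResidue.HasResidue P (z P) ω 0) ↔
      Ideal.Quotient.mk
        (Ideal.span {CurveResidue.toRegular L (h𝒬.monic.map (mapRingHom (algebraMap _ K)))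
          (AdjoinRoot.of (CurveResidue.genericFibre K 𝒬) (r.map (algebraMap _ K)))})
        (CurveResidue.toRegular L (h𝒬.monic.map (mapRingHom (algebraMap _ K)))
          (AdjoinRoot.mk (CurveResidue.genericFibre K 𝒬)
              (derivative (CurveResidue.genericFibre K 𝒬)) *
            ∑ i, AdjoinRoot.of (CurveResidue.genericFibre K 𝒬) (u i) *
              AdjoinRoot.root (CurveResidue.genericFibre K 𝒬) ^ (i : ℕ))) = 0 := by
  have := CurveResidue.charZero_wittVector p k
  have hKinj : Function.Injective (algebraMap (WittVector p k) K) := IsFractionRing.injective _ _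
  have : CharZero K := charZero_of_injective_algebraMap hKinj
  have hmon := h𝒬.monic.map (mapRingHom (algebraMap (WittVector p k) K))
  have hdom : IsDomain (AdjoinRoot (CurveResidue.genericFibre K 𝒬)) :=
    (IsFractionRing.injective (AdjoinRoot (CurveResidue.genericFibre K 𝒬)) L).isDomain
  have hdiscr : 𝒬.discr ≠ 0 := CurveResidue.discr_ne_zero (K := K) h𝒬.monic
    (CurveResidue.irreducible_of_isDomain_adjoinRoot hmon.ne_zero hdom)
  have hsep : (r.map (algebraMap (WittVector p k) K)).Separable := hr.separable_map hdiscr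
  rw [hω]
  have h := CurveResidue.forall_hasResidue_zero_iff (L := L) hmon hsmooth hsep z hz
    (∑ i, AdjoinRoot.of (CurveResidue.genericFibre K 𝒬) (u i) *
      AdjoinRoot.root (CurveResidue.genericFibre K 𝒬) ^ (i : ℕ))
  simp only [map_sum, map_mul, map_pow] at h ⊢
  exact h
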